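/- Let $n,m\ge 1$, let $D_X\in\mathbb{R}^{n\times n}$ and $D_Y\in\mathbb{R}^{m\times m}$ be symmetric matrices, and let $\mu\in\mathbb{R}^n$ and $\nu\in\mathbb{R}^m$ be probability vectors (nonnegative entries summing to $1$). Equip $\mathbb{R}^{n\times m}$ with the Frobenius inner product and norm $\|\cdot\|$, and put $$C_1=\{\pi\in\mathbb{R}^{n\times m}:\pi\ge 0,\ \pi\mathbf 1_m=\mu\},\qquad C_2=\{\pi\in\mathbb{R}^{n\times m}:\pi\ge 0,\ \pi^T\mathbf 1_n=\nu\},\qquad f(\pi)=-\operatorname{Tr}(D_X\pi D_Y\pi^T).$$ Let $$\mathcal X=\{\pi\in C_1\cap C_2:\ 0\in\nabla f(\pi)+\mathcal N_{C_1}(\pi)+\mathcal N_{C_2}(\pi)\}$$ be the set of critical points of the discrete Gromov--Wasserstein problem $\min_{\pi\in C_1\cap C_2}f(\pi)$, where $\mathcal N_C(\pi)=\{g:\langle g,y-\pi\rangle\le 0\ \text{for all } y\in C\}$ is the normal cone to $C$ at $\pi\in C$, and let $\operatorname{proj}_{C_1\cap C_2}$ be the metric projection onto $C_1\cap C_2$.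 Then $\mathcal X$ is nonempty, and there exist $\epsilon>0$ and $\tau>0$ such that for every $\pi\in\mathbb{R}^{n\times m}$ with $$\bigl\|\pi-\operatorname{proj}_{C_1\cap C_2}(\pi+D_X\pi D_Y)\bigr\|\le\epsilon$$ one has $$\operatorname{dist}(\pi,\mathcal X)\le\tau\,\bigl\|\pi-\operatorname{proj}_{C_1\cap C_2}(\pi+D_X\pi D_Y)\bigr\|,$$ where $\operatorname{dist}(\pi,\mathcal X)=\inf_{x\in\mathcal X}\|\pi-x\|$. -/

import Mathlib

open scoped Matrix Matrix.Norms.Frobenius Pointwise Gradient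

namespace GW

/-- The Frobenius inner product `⟪A, B⟫ = Tr(Aᵀ B) = ∑ i j, A i j * B i j`; its norm is Mathlib's
Frobenius norm. -/
noncomputable instance frobeniusInnerProductSpace {n m : ℕ} :
    InnerProductSpace ℝ (Matrix (Fin n) (Fin m) ℝ) where
  inner A B := (Aᵀ * B).trace
  norm_sq_eq_re_inner A := by
    have h0 : (0 : ℝ) ≤ ∑ i, ∑ j, A i j ^ 2 :=
      Finset.sum_nonneg fun i _ => Finset.sum_nonneg fun j _ => sq_nonneg _
    have h1 : ‖A‖ ^ 2 = ∑ i, ∑ j, A i j ^ 2 := by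
      rw [Matrix.frobenius_norm_def, ← Real.sqrt_eq_rpow]
      simp only [Real.rpow_two, Real.norm_eq_abs, sq_abs]
      exact Real.sq_sqrt h0
    rw [h1, Finset.sum_comm]
    simp [Matrix.trace, Matrix.mul_apply, sq]
  conj_inner_symm A B := by
    simp only [conj_trivial]
    rw [← Matrix.trace_transpose, Matrix.transpose_mul, Matrix.transpose_transpose]
  add_left A B C := by
    rw [Matrix.transpose_add, Matrix.add_mul, Matrix.trace_add]
  smul_left A B r := by
    simp only [conj_trivial, Matrix.transpose_smul, Matrix.smul_mul, Matrix.trace_smul,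
      smul_eq_mul]

section InnerProduct

variable {E : Type*} [NormedAddCommGroup E] [InnerProductSpace ℝ E]

/-- The normal cone to a convex set `C` at `x` (empty if `x ∉ C`). -/
def normalCone (C : Set E) (x : E) : Set E :=
  {g | x ∈ C ∧ ∀ y ∈ C, inner ℝ g (y - x) ≤ 0}

/-- `p` is a point of `C` nearest to `x`. -/
def IsProj (C : Set E) (x p : E) : Prop :=
  p ∈ C ∧ ∀ y ∈ C, ‖x - p‖ ≤ ‖x - y‖

/-- The metric projection onto `C`: the nearest point of `C`, which exists and is unique if `C` is
nonempty, complete and convex (`isProj_proj`, `IsProj.eq_proj`). -/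
noncomputable def proj (C : Set E) (x : E) : E :=
  Classical.epsilon (IsProj C x)

theorem isProj_proj {C : Set E} (hne : C.Nonempty) (hC : IsComplete C) (hconv : Convex ℝ C)
    (x : E) : IsProj C x (proj C x) := by
  refine Classical.epsilon_spec (p := IsProj C x) ?_
  obtain ⟨p, hp, h⟩ := exists_norm_eq_iInf_of_complete_convex hne hC hconv x
  refine ⟨p, hp, fun y hy => ?_⟩
  rw [h]
  exact ciInf_le ⟨0, by rintro _ ⟨w, rfl⟩; exact norm_nonneg _⟩ (⟨y, hy⟩ : C)

theorem IsProj.inner_le_zero {C : Set E} (hconv : Convex ℝ C) {x p : E} (h : IsProj C x p) :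
    ∀ y ∈ C, inner ℝ (x - p) (y - p) ≤ 0 := by
  refine (norm_eq_iInf_iff_real_inner_le_zero hconv h.1).1 (le_antisymm ?_ ?_)
  · have : Nonempty C := ⟨⟨p, h.1⟩⟩
    exact le_ciInf fun w => h.2 w w.2
  · exact ciInf_le ⟨0, by rintro _ ⟨w, rfl⟩; exact norm_nonneg _⟩ (⟨p, h.1⟩ : C)

theorem IsProj.eq_proj {C : Set E} (hC : IsComplete C) (hconv : Convex ℝ C) {x p : E}
    (h : IsProj C x p) : p = proj C x := by
  have h' := isProj_proj ⟨p, h.1⟩ hC hconv x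
  have h1 := h.inner_le_zero hconv _ h'.1
  have h2 := h'.inner_le_zero hconv _ h.1
  have h3 : inner ℝ (p - proj C x) (p - proj C x) ≤ 0 := by
    have e : inner ℝ (p - proj C x) (p - proj C x)
        = inner ℝ (x - p) (proj C x - p) + inner ℝ (x - proj C x) (p - proj C x) := by
      rw [← neg_sub p (proj C x), inner_neg_right, ← sub_eq_neg_add, ← inner_sub_left]
      congr 1
      abel
    linarith
  exact sub_eq_zero.1 (real_inner_self_nonpos.1 h3)

end InnerProduct

/-- The row constraint set `{π ≥ 0 : π 1_m = μ}`. -/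
def C₁ {n : ℕ} (m : ℕ) (μ : Fin n → ℝ) : Set (Matrix (Fin n) (Fin m) ℝ) :=
  {π | (∀ i j, 0 ≤ π i j) ∧ π *ᵥ 1 = μ}

/-- The column constraint set `{π ≥ 0 : πᵀ 1_n = ν}`. -/
def C₂ (n : ℕ) {m : ℕ} (ν : Fin m → ℝ) : Set (Matrix (Fin n) (Fin m) ℝ) :=
  {π | (∀ i j, 0 ≤ π i j) ∧ πᵀ *ᵥ 1 = ν}

/-- The objective `f(π) = -Tr(D_X π D_Y πᵀ)`. -/
noncomputable def objective {n m : ℕ} (DX : Matrix (Fin n) (Fin n) ℝ)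
    (DY : Matrix (Fin m) (Fin m) ℝ) (π : Matrix (Fin n) (Fin m) ℝ) : ℝ :=
  -(DX * π * DY * πᵀ).trace

/-- The critical point set
`{π ∈ C₁ ∩ C₂ : 0 ∈ ∇f(π) + N_{C₁}(π) + N_{C₂}(π)}`. -/
def criticalSet {n m : ℕ} (DX : Matrix (Fin n) (Fin n) ℝ) (DY : Matrix (Fin m) (Fin m) ℝ)
    (μ : Fin n → ℝ) (ν : Fin m → ℝ) : Set (Matrix (Fin n) (Fin m) ℝ) :=
  {π | π ∈ C₁ m μ ∩ C₂ n ν ∧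
    0 ∈ {∇ (objective DX DY) π} + normalCone (C₁ m μ) π + normalCone (C₂ n ν) π}

/-- The residual `‖π - proj_{C₁ ∩ C₂}(π + D_X π D_Y)‖`. -/
noncomputable def residual {n m : ℕ} (DX : Matrix (Fin n) (Fin n) ℝ)
    (DY : Matrix (Fin m) (Fin m) ℝ) (μ : Fin n → ℝ) (ν : Fin m → ℝ)
    (π : Matrix (Fin n) (Fin m) ℝ) : ℝ :=
  ‖π - proj (C₁ m μ ∩ C₂ n ν) (π + DX * π * DY)‖

end GW

/-!
A matrix is critical exactly when `D_X π D_Y` lies in the normal cone to the polytope `C₁ ∩ C₂` at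
`π`, because normal cones of polyhedra add under intersection (Farkas). A projection residual of
size `r` says that `p = proj (π + D_X π D_Y)` satisfies this condition up to a perturbation of size
`O(r)`.

Once the set `J` of constraints allowed to carry multipliers is fixed, the Karush-Kuhn-Tucker
conditions become a linear system over a polyhedron in the primal and dual variables jointly. By
Hoffman's bound its solution set is Lipschitz in the right-hand side, and if it is empty it stays
empty for nearby right-hand sides, since linear images of polyhedra are closed. There are finitely
many `J`. Hoffman's bound itself is proved by moving within a fibre of the linear map to a point
minimising the sum of the constraint functionals; on the face of such a point the map has trivial
kernel, hence is bounded below, and there are finitely many faces.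
-/

namespace GW

open Set Filter Topology NNReal
open scoped RealInnerProductSpace

theorem eventually_add_mul_le {α β r : ℝ} (hα : α ≤ r) (hβ : α = r → β ≤ 0) :
    ∀ᶠ t in 𝓝[>] (0 : ℝ), α + t * β ≤ r := by
  rcases hα.eq_or_lt with rfl | hlt
  · filter_upwards [self_mem_nhdsWithin] with t ht
    linarith [mul_nonpos_of_nonneg_of_nonpos (le_of_lt ht) (hβ rfl)]
  · have hlim : Tendsto (fun t : ℝ => α + t * β) (𝓝[>] 0) (𝓝 (α + 0 * β)) :=
      (Continuous.tendsto (by fun_prop) 0).mono_left nhdsWithin_le_nhds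
    rw [zero_mul, add_zero] at hlim
    exact (hlim.eventually (gt_mem_nhds hlt)).mono fun t => le_of_lt

section NonnegOn

variable {ι : Type*}

/-- The range of the `i`-th member of a family of nonnegative reals supported in `J`: the half-line
`[0, ∞)` if `i ∈ J`, and `{0}` otherwise. It encodes complementary slackness, with multipliers
supported in `J` and slacks supported in `Jᶜ`. -/
def nonnegOn (J : Set ι) (i : ι) : Set ℝ :=
  {r | 0 ≤ r ∧ (i ∉ J → r = 0)}

theorem isClosed_nonnegOn (J : Set ι) (i : ι) : IsClosed (nonnegOn J i) := by
  simp only [nonnegOn, ofPred_and, ofPred_forall]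
  exact isClosed_Ici.inter (isClosed_iInter fun _ => isClosed_singleton)

theorem ordConnected_nonnegOn (J : Set ι) (i : ι) : OrdConnected (nonnegOn J i) :=
  ⟨fun _ hr _ hs _ ht => ⟨hr.1.trans ht.1, fun hi =>
    le_antisymm (ht.2.trans_eq (hs.2 hi)) (hr.1.trans ht.1)⟩⟩

theorem mul_mem_nonnegOn {J : Set ι} {i : ι} {r s : ℝ} (hr : 0 ≤ r)
    (hs : s ∈ nonnegOn J i) : r * s ∈ nonnegOn J i :=
  ⟨mul_nonneg hr hs.1, fun hi => by rw [hs.2 hi, mul_zero]⟩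

end NonnegOn

section Fibers

variable {E F ι : Type*} [NormedAddCommGroup E] [NormedSpace ℝ E]
  [NormedAddCommGroup F] [NormedSpace ℝ F]

variable [FiniteDimensional ℝ E]

theorem exists_norm_le_mul_norm_of_isClosed_cone {K : Set E} (hK : IsClosed K)
    (hsmul : ∀ r : ℝ, 0 < r → ∀ x ∈ K, r • x ∈ K) (T : E →ₗ[ℝ] F)
    (hT : ∀ x ∈ K, T x = 0 → x = 0) : ∃ c : ℝ≥0, ∀ x ∈ K, ‖x‖ ≤ c * ‖T x‖ := by
  have hpos : ∀ x ∈ Metric.sphere (0 : E) 1 ∩ K, 0 < ‖T x‖ := fun x hx =>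
    norm_pos_iff.2 fun h => Metric.ne_of_mem_sphere hx.1 one_ne_zero (hT x hx.2 h)
  obtain ⟨δ, hδ, hmin⟩ := ((isCompact_sphere (0 : E) 1).inter_right hK).exists_forall_le'
    T.continuous_of_finiteDimensional.norm.continuousOn hpos
  refine ⟨(δ⁻¹).toNNReal, fun x hx => ?_⟩
  rcases eq_or_ne x 0 with rfl | hx0
  · simp
  have hunit : ‖x‖⁻¹ • x ∈ Metric.sphere (0 : E) 1 ∩ K :=
    ⟨by simp [norm_smul, norm_ne_zero_iff.2 hx0], hsmul _ (by positivity) x hx⟩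
  have hle := hmin _ hunit
  rw [map_smul, norm_smul, norm_inv, norm_norm, ← div_eq_inv_mul,
    le_div_iff₀ (norm_pos_iff.2 hx0)] at hle
  rw [Real.coe_toNNReal _ (by positivity), ← div_eq_inv_mul, le_div_iff₀ hδ]
  linarith

theorem isClosed_forall_mem {ℓ : ι → E →ₗ[ℝ] ℝ} {I : ι → Set ℝ} (hI : ∀ i, IsClosed (I i)) :
    IsClosed {x | ∀ i, ℓ i x ∈ I i} := by
  simp only [ofPred_forall]
  exact isClosed_iInter fun i => (hI i).preimage (ℓ i).continuous_of_finiteDimensional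

variable [Finite ι]

theorem isCompact_forall_mem {ℓ : ι → E →ₗ[ℝ] ℝ} (hℓ : ∀ x, (∀ i, ℓ i x = 0) → x = 0)
    {I : ι → Set ℝ} (hI : ∀ i, IsCompact (I i)) : IsCompact {x | ∀ i, ℓ i x ∈ I i} := by
  have := Fintype.ofFinite ι
  have hker : LinearMap.ker (LinearMap.pi ℓ) = ⊥ :=
    LinearMap.ker_eq_bot'.2 fun x hx => hℓ x (congrFun hx)
  exact (LinearMap.isClosedEmbedding_of_injective hker).isCompact_preimage
    (isCompact_pi_infinite hI)

theorem exists_minimal_mem_fiber {ℓ : ι → E →ₗ[ℝ] ℝ} (hℓ : ∀ x, (∀ i, ℓ i x = 0) → x = 0)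
    (T : E →ₗ[ℝ] F) {z : E} (hz : ∀ i, 0 ≤ ℓ i z) :
    ∃ w, (∀ i, ℓ i w ∈ Icc 0 (ℓ i z)) ∧ T w = T z ∧
      ∀ k, (∀ i, ℓ i k ∈ nonnegOn {i | ℓ i w ≠ 0} i) → T k = 0 → k = 0 := by
  have := Fintype.ofFinite ι
  have hcont (i : ι) : Continuous (ℓ i) := (ℓ i).continuous_of_finiteDimensional
  have hcompact : IsCompact ({w | ∀ i, ℓ i w ∈ Icc 0 (ℓ i z)} ∩ {w | T w = T z}) :=
    (isCompact_forall_mem hℓ fun _ => isCompact_Icc).inter_right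
      (isClosed_eq T.continuous_of_finiteDimensional continuous_const)
  obtain ⟨w, ⟨hw, hTw⟩, hmin⟩ := hcompact.exists_isMinOn
    ⟨z, fun i => ⟨hz i, le_rfl⟩, rfl⟩ (f := fun w => ∑ i, ℓ i w) (by fun_prop)
  -- A kernel vector `k ≠ 0` of the face of `w` would make `-k` a descent direction for `∑ i, ℓ i`.
  refine ⟨w, hw, hTw, fun k hk hTk => ?_⟩
  have hlower : ∀ᶠ t in 𝓝[>] (0 : ℝ), ∀ i, -ℓ i w + t * ℓ i k ≤ 0 :=
    eventually_all.2 fun i => eventually_add_mul_le (neg_nonpos.2 (hw i).1) fun h =>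
      ((hk i).2 (not_not.2 (neg_eq_zero.1 h))).le
  obtain ⟨t, ht, ht0 : 0 < t⟩ := (hlower.and self_mem_nhdsWithin).exists
  have hstep : w - t • k ∈ {w | ∀ i, ℓ i w ∈ Icc 0 (ℓ i z)} ∩ {w | T w = T z} := by
    refine ⟨fun i => ?_, by simpa [hTk] using hTw⟩
    have := mul_nonneg ht0.le (hk i).1
    simp only [map_sub, map_smul, smul_eq_mul]
    exact ⟨by linarith [ht i], by linarith [(hw i).2]⟩
  have hsum : ∑ i, ℓ i w ≤ ∑ i, ℓ i (w - t • k) := hmin hstep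
  simp only [map_sub, map_smul, smul_eq_mul, Finset.sum_sub_distrib, ← Finset.mul_sum] at hsum
  have hzero : ∑ i, ℓ i k = 0 :=
    le_antisymm (nonpos_of_mul_nonpos_right (by linarith) ht0)
      (Finset.sum_nonneg fun i _ => (hk i).1)
  exact hℓ k fun i =>
    (Finset.sum_eq_zero_iff_of_nonneg fun i _ => (hk i).1).1 hzero i (Finset.mem_univ i)

theorem exists_fiber_bound_of_nonneg {ℓ : ι → E →ₗ[ℝ] ℝ} (hℓ : ∀ x, (∀ i, ℓ i x = 0) → x = 0)
    (T : E →ₗ[ℝ] F) : ∃ c : ℝ≥0, ∀ z, (∀ i, 0 ≤ ℓ i z) →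
      ∃ w, (∀ i, ℓ i w ∈ Icc 0 (ℓ i z)) ∧ T w = T z ∧ ‖w‖ ≤ c * ‖T z‖ := by
  have hface (J : Set ι) : ∃ c : ℝ≥0,
      (∀ k, (∀ i, ℓ i k ∈ nonnegOn J i) → T k = 0 → k = 0) →
        ∀ w, (∀ i, ℓ i w ∈ nonnegOn J i) → ‖w‖ ≤ c * ‖T w‖ := by
    by_cases hJ : ∀ k, (∀ i, ℓ i k ∈ nonnegOn J i) → T k = 0 → k = 0
    · obtain ⟨c, hc⟩ := exists_norm_le_mul_norm_of_isClosed_cone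
        (isClosed_forall_mem (isClosed_nonnegOn J))
        (fun r hr x hx i => by simpa using mul_mem_nonnegOn hr.le (hx i)) T hJ
      exact ⟨c, fun _ => hc⟩
    · exact ⟨0, fun h => absurd h hJ⟩
  choose c hc using hface
  obtain ⟨M, hM⟩ := Finite.exists_le c
  refine ⟨M, fun z hz => ?_⟩
  obtain ⟨w, hw, hTw, hinj⟩ := exists_minimal_mem_fiber hℓ T hz
  refine ⟨w, hw, hTw, ?_⟩
  calc ‖w‖ ≤ c {i | ℓ i w ≠ 0} * ‖T w‖ :=
        hc _ hinj w fun i => ⟨(hw i).1, not_not.1⟩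
    _ ≤ M * ‖T z‖ := by
      rw [hTw]
      gcongr
      exact hM _

theorem exists_fiber_bound_of_separating {ℓ : ι → E →ₗ[ℝ] ℝ}
    (hℓ : ∀ x, (∀ i, ℓ i x = 0) → x = 0) (T : E →ₗ[ℝ] F) : ∃ c : ℝ≥0, ∀ x y,
      ∃ w, (∀ i, ℓ i w ∈ uIcc (ℓ i x) (ℓ i y)) ∧ T w = T y ∧ ‖w - x‖ ≤ c * ‖T y - T x‖ := by
  have hsign (s : ι → ℤˣ) := exists_fiber_bound_of_nonneg (ℓ := fun i => (s i : ℤ) • ℓ i)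
    (fun x hx => hℓ x fun i => by simpa using hx i) T
  choose c hc using hsign
  obtain ⟨M, hM⟩ := Finite.exists_le c
  refine ⟨M, fun x y => ?_⟩
  have horient (i : ι) : ∃ s : ℤˣ, 0 ≤ ((s : ℤ) • ℓ i) (y - x) :=
    (le_total 0 (ℓ i (y - x))).elim (fun h => ⟨1, by simpa using h⟩)
      fun h => ⟨-1, by simpa using h⟩
  choose s hs using horient
  obtain ⟨v, hv, hTv, hle⟩ := hc s (y - x) hs
  refine ⟨x + v, fun i => ?_, by rw [map_add, hTv, map_sub, add_sub_cancel], ?_⟩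
  · have hvi := hv i
    rcases Int.units_eq_one_or (s i) with h | h
    · simp only [h, Units.val_one, one_smul, map_sub, mem_Icc] at hvi
      rw [map_add]
      exact mem_uIcc.2 (.inl ⟨by linarith, by linarith⟩)
    · simp only [h, Units.val_neg, Units.val_one, neg_smul, one_smul, LinearMap.neg_apply,
        map_sub, mem_Icc] at hvi
      rw [map_add]
      exact mem_uIcc.2 (.inr ⟨by linarith, by linarith⟩)
  · rw [add_sub_cancel_left, ← map_sub]
    exact hle.trans (by gcongr; exact hM s)

/-- Adding the coordinates in a basis to `ℓ` separates points without weakening the conclusion. -/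
theorem exists_fiber_bound (ℓ : ι → E →ₗ[ℝ] ℝ) (T : E →ₗ[ℝ] F) : ∃ c : ℝ≥0, ∀ x y,
    ∃ w, (∀ i, ℓ i w ∈ uIcc (ℓ i x) (ℓ i y)) ∧ T w = T y ∧ ‖w - x‖ ≤ c * ‖T y - T x‖ := by
  let B := Module.finBasis ℝ E
  obtain ⟨c, hc⟩ := exists_fiber_bound_of_separating (ℓ := Sum.elim ℓ B.coord)
    (fun x hx => (B.forall_coord_eq_zero_iff).1 fun j => hx (.inr j)) T
  refine ⟨c, fun x y => ?_⟩
  obtain ⟨w, hw, hTw, hle⟩ := hc x y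
  exact ⟨w, fun i => hw (.inl i), hTw, hle⟩

theorem isClosed_image_forall_mem {ℓ : ι → E →ₗ[ℝ] ℝ} {I : ι → Set ℝ}
    (hI : ∀ i, IsClosed (I i)) (hconn : ∀ i, OrdConnected (I i)) (T : E →ₗ[ℝ] F) :
    IsClosed (T '' {x | ∀ i, ℓ i x ∈ I i}) := by
  rcases {x | ∀ i, ℓ i x ∈ I i}.eq_empty_or_nonempty with hempty | ⟨x₀, hx₀⟩
  · simp [hempty]
  obtain ⟨c, hc⟩ := exists_fiber_bound ℓ T
  refine IsSeqClosed.isClosed fun t t₀ ht hlim => ?_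
  obtain ⟨R, hR⟩ := (Metric.isBounded_range_of_tendsto t hlim).subset_closedBall (T x₀)
  have hcompact : IsCompact (T '' ({x | ∀ i, ℓ i x ∈ I i} ∩ Metric.closedBall x₀ (c * R))) :=
    ((isCompact_closedBall x₀ (c * R)).inter_left (isClosed_forall_mem hI)).image
      T.continuous_of_finiteDimensional
  refine image_mono inter_subset_left
    (hcompact.isClosed.mem_of_tendsto hlim (.of_forall fun k => ?_))
  obtain ⟨y, hy, hyk⟩ := ht k
  obtain ⟨w, hw, hTw, hle⟩ := hc x₀ y
  have hdist : ‖T y - T x₀‖ ≤ R := hyk ▸ mem_closedBall_iff_norm.1 (hR ⟨k, rfl⟩)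
  exact ⟨w, ⟨fun i => (hconn i).uIcc_subset (hx₀ i) (hy i) (hw i),
    mem_closedBall_iff_norm.2 (hle.trans (by gcongr))⟩, hTw.trans hyk⟩

theorem exists_linear_system_error_bound (ℓ : ι → E →ₗ[ℝ] ℝ) (T : E →ₗ[ℝ] F) :
    ∃ c : ℝ≥0, ∀ I : ι → Set ℝ, (∀ i, IsClosed (I i)) → (∀ i, OrdConnected (I i)) → ∀ t : F,
      ∃ ε > 0, ∀ x, (∀ i, ℓ i x ∈ I i) → ‖T x - t‖ ≤ ε →
        ∃ y, (∀ i, ℓ i y ∈ I i) ∧ T y = t ∧ ‖x - y‖ ≤ c * ‖T x - t‖ := by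
  obtain ⟨c, hc⟩ := exists_fiber_bound ℓ T
  refine ⟨c, fun I hI hconn t => ?_⟩
  by_cases ht : t ∈ T '' {x | ∀ i, ℓ i x ∈ I i}
  · obtain ⟨z, hz, rfl⟩ := ht
    refine ⟨1, one_pos, fun x hx _ => ?_⟩
    obtain ⟨y, hy, hTy, hle⟩ := hc x z
    exact ⟨y, fun i => (hconn i).uIcc_subset (hx i) (hz i) (hy i), hTy,
      by rwa [norm_sub_rev, norm_sub_rev (T x)]⟩
  · obtain ⟨ε, hε, hball⟩ := Metric.nhds_basis_closedBall.mem_iff.1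
      ((isClosed_image_forall_mem hI hconn T).isOpen_compl.mem_nhds ht)
    exact ⟨ε, hε, fun x hx hle =>
      absurd ⟨x, hx, rfl⟩ (hball (mem_closedBall_iff_norm.2 hle))⟩

end Fibers

section Polyhedra

variable {E ι κ : Type*} [NormedAddCommGroup E] [InnerProductSpace ℝ E]

/-- The solution set of the system of linear inequalities `⟪a i, x⟫ ≤ b i`. -/
def polyhedron (a : ι → E) (b : ι → ℝ) : Set E :=
  {x | ∀ i, ⟪a i, x⟫ ≤ b i}

/-- A set cut out by finitely many linear inequalities. -/
def IsPolyhedral (C : Set E) : Prop :=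
  ∃ (k : ℕ) (a : Fin k → E) (b : Fin k → ℝ), C = polyhedron a b

theorem polyhedron_inter_polyhedron (a : ι → E) (b : ι → ℝ) (a' : κ → E) (b' : κ → ℝ) :
    polyhedron a b ∩ polyhedron a' b' = polyhedron (Sum.elim a a') (Sum.elim b b') :=
  Set.ext fun _ => by simp [polyhedron]

theorem isPolyhedral_polyhedron [Finite ι] (a : ι → E) (b : ι → ℝ) :
    IsPolyhedral (polyhedron a b) :=
  let e := Finite.equivFin ι
  ⟨_, a ∘ e.symm, b ∘ e.symm, Set.ext fun _ => e.symm.surjective.forall⟩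

theorem IsPolyhedral.inter {C D : Set E} (hC : IsPolyhedral C) (hD : IsPolyhedral D) :
    IsPolyhedral (C ∩ D) := by
  obtain ⟨k, a, b, rfl⟩ := hC
  obtain ⟨l, a', b', rfl⟩ := hD
  exact polyhedron_inter_polyhedron a b a' b' ▸ isPolyhedral_polyhedron _ _

theorem IsPolyhedral.iInter [Finite κ] {C : κ → Set E} (hC : ∀ j, IsPolyhedral (C j)) :
    IsPolyhedral (⋂ j, C j) := by
  choose k a b h using hC
  have hsigma : ⋂ j, C j = polyhedron (fun p : Σ j, Fin (k j) => a p.1 p.2) fun p => b p.1 p.2 := by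
    ext x
    simp only [h, mem_iInter, polyhedron, mem_ofPred_eq, Sigma.forall]
  exact hsigma ▸ isPolyhedral_polyhedron _ _

theorem isPolyhedral_setOf_le [CompleteSpace E] (f : E →L[ℝ] ℝ) (r : ℝ) :
    IsPolyhedral {x | f x ≤ r} := by
  have hriesz : {x | f x ≤ r} =
      polyhedron (fun _ : Unit => (InnerProductSpace.toDual ℝ E).symm f) fun _ => r := by
    simp [polyhedron]
  exact hriesz ▸ isPolyhedral_polyhedron _ _

theorem isPolyhedral_setOf_ge [CompleteSpace E] (f : E →L[ℝ] ℝ) (r : ℝ) :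
    IsPolyhedral {x | r ≤ f x} := by
  simpa using isPolyhedral_setOf_le (-f) (-r)

theorem isPolyhedral_setOf_eq [CompleteSpace E] (f : E →L[ℝ] ℝ) (r : ℝ) :
    IsPolyhedral {x | f x = r} := by
  simpa only [le_antisymm_iff, ofPred_and] using
    (isPolyhedral_setOf_le f r).inter (isPolyhedral_setOf_ge f r)

theorem IsPolyhedral.convex {C : Set E} (hC : IsPolyhedral C) : Convex ℝ C := by
  obtain ⟨k, a, b, rfl⟩ := hC
  simp only [polyhedron, ofPred_forall]
  exact convex_iInter fun i => convex_halfSpace_le (innerₗ E (a i)).isLinear (b i)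

theorem IsPolyhedral.isClosed {C : Set E} (hC : IsPolyhedral C) : IsClosed C := by
  obtain ⟨k, a, b, rfl⟩ := hC
  simp only [polyhedron, ofPred_forall]
  exact isClosed_iInter fun i => isClosed_le (by fun_prop) continuous_const

end Polyhedra

section Farkas

variable {E ι : Type*} [NormedAddCommGroup E]

theorem mem_hull_image_iff [Fintype ι] [NormedSpace ℝ E] {a : ι → E} {J : Set ι} {g : E} :
    g ∈ PointedCone.hull ℝ (a '' J) ↔
      ∃ c : ι → ℝ, (∀ i, c i ∈ nonnegOn J i) ∧ ∑ i, c i • a i = g := by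
  classical
  constructor
  · intro hg
    rw [← J.coe_toFinset, Submodule.mem_span_image_finset_iff_exists_fun'] at hg
    obtain ⟨c, rfl⟩ := hg
    refine ⟨fun i => if i ∈ J then (c i : ℝ) else 0, fun i => ⟨?_, fun hi => if_neg hi⟩, ?_⟩
    · exact ite_nonneg (c i).2 le_rfl
    · simp [ite_smul, ← Finset.sum_filter, Set.filter_mem_univ_eq_toFinset]
  · rintro ⟨c, hc, rfl⟩
    refine Submodule.sum_mem _ fun i _ => ?_
    by_cases hi : i ∈ J
    · exact Submodule.smul_mem _ (⟨c i, (hc i).1⟩ : ℝ≥0)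
        (PointedCone.subset_hull (mem_image_of_mem a hi))
    · simp [(hc i).2 hi]

theorem isClosed_hull_image [Finite ι] [NormedSpace ℝ E] (a : ι → E) (J : Set ι) :
    IsClosed (PointedCone.hull ℝ (a '' J) : Set E) := by
  have := Fintype.ofFinite ι
  have himage : (PointedCone.hull ℝ (a '' J) : Set E) = Fintype.linearCombination ℝ a ''
      {c | ∀ i, (LinearMap.proj i : (ι → ℝ) →ₗ[ℝ] ℝ) c ∈ nonnegOn J i} :=
    Set.ext fun _ => mem_hull_image_iff
  exact himage ▸ isClosed_image_forall_mem (isClosed_nonnegOn J) (ordConnected_nonnegOn J) _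

theorem farkas [Fintype ι] [InnerProductSpace ℝ E] [CompleteSpace E] {a : ι → E} {J : Set ι} {g : E}
    (hg : ∀ v, (∀ i ∈ J, ⟪a i, v⟫ ≤ 0) → ⟪g, v⟫ ≤ 0) :
    ∃ c : ι → ℝ, (∀ i, c i ∈ nonnegOn J i) ∧ ∑ i, c i • a i = g := by
  rw [← mem_hull_image_iff]
  by_contra hmem
  let K : ProperCone ℝ E := ⟨PointedCone.hull ℝ (a '' J), isClosed_hull_image a J⟩
  obtain ⟨v, hv, hgv⟩ := K.hyperplane_separation' (x₀ := g) hmem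
  have hneg := hg (-v) fun i hi => by
    simpa using hv _ (PointedCone.subset_hull (mem_image_of_mem a hi))
  rw [inner_neg_right] at hneg
  linarith

end Farkas

section NormalCone

variable {E ι : Type*} [NormedAddCommGroup E] [InnerProductSpace ℝ E]

theorem smul_mem_normalCone_iff {C : Set E} {x g : E} {r : ℝ} (hr : 0 < r) :
    r • g ∈ normalCone C x ↔ g ∈ normalCone C x := by
  simp only [normalCone, mem_ofPred_eq, real_inner_smul_left, ← le_div_iff₀' hr, zero_div]

theorem normalCone_add_subset (C D : Set E) (x : E) :
    normalCone C x + normalCone D x ⊆ normalCone (C ∩ D) x := by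
  rintro _ ⟨g, ⟨hxC, hg⟩, h, ⟨hxD, hh⟩, rfl⟩
  refine ⟨⟨hxC, hxD⟩, fun y hy => ?_⟩
  rw [inner_add_left]
  exact add_nonpos (hg y hy.1) (hh y hy.2)

theorem IsProj.sub_mem_normalCone {C : Set E} (hC : Convex ℝ C) {x p : E} (hp : IsProj C x p) :
    x - p ∈ normalCone C p :=
  ⟨hp.1, hp.inner_le_zero hC⟩

theorem mem_normalCone_polyhedron_iff [CompleteSpace E] [Fintype ι] {a : ι → E} {b : ι → ℝ}
    {x g : E} : g ∈ normalCone (polyhedron a b) x ↔ ∃ (J : Set ι) (c : ι → ℝ),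
      (∀ i, b i - ⟪a i, x⟫ ∈ nonnegOn Jᶜ i) ∧ (∀ i, c i ∈ nonnegOn J i) ∧
        ∑ i, c i • a i = g := by
  constructor
  · rintro ⟨hx, hg⟩
    obtain ⟨c, hc, hcg⟩ := farkas (a := a) (J := {i | ⟪a i, x⟫ = b i}) (g := g) fun v hv => by
      obtain ⟨t, ht, ht0 : 0 < t⟩ := ((eventually_all.2 fun i =>
        eventually_add_mul_le (hx i) (hv i)).and self_mem_nhdsWithin).exists
      have hmove := hg (x + t • v) fun i => by
        rw [inner_add_right, real_inner_smul_right]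
        exact ht i
      rw [add_sub_cancel_left, real_inner_smul_right] at hmove
      exact nonpos_of_mul_nonpos_right hmove ht0
    exact ⟨{i | ⟪a i, x⟫ = b i}, c, fun i =>
      ⟨sub_nonneg.2 (hx i), fun hi => sub_eq_zero.2 (not_not.1 hi).symm⟩, hc, hcg⟩
  · rintro ⟨J, c, hslack, hc, rfl⟩
    refine ⟨fun i => sub_nonneg.1 (hslack i).1, fun y hy => ?_⟩
    rw [sum_inner]
    refine Finset.sum_nonpos fun i _ => ?_
    rw [real_inner_smul_left, inner_sub_right]
    by_cases hi : i ∈ J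
    · have hactive : b i - ⟪a i, x⟫ = 0 := (hslack i).2 (not_not.2 hi)
      exact mul_nonpos_of_nonneg_of_nonpos (hc i).1 (by linarith [hy i])
    · rw [(hc i).2 hi, zero_mul]

theorem IsPolyhedral.normalCone_inter [CompleteSpace E] {C D : Set E} (hC : IsPolyhedral C)
    (hD : IsPolyhedral D) (x : E) :
    normalCone (C ∩ D) x = normalCone C x + normalCone D x := by
  refine Subset.antisymm (fun g hg => ?_) (normalCone_add_subset C D x)
  obtain ⟨k, a, b, rfl⟩ := hC
  obtain ⟨l, a', b', rfl⟩ := hD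
  rw [polyhedron_inter_polyhedron, mem_normalCone_polyhedron_iff] at hg
  obtain ⟨J, c, hslack, hc, rfl⟩ := hg
  rw [Fintype.sum_sum_type]
  exact add_mem_add
    (mem_normalCone_polyhedron_iff.2 ⟨Sum.inl ⁻¹' J, c ∘ Sum.inl, fun i => hslack (.inl i),
      fun i => hc (.inl i), rfl⟩)
    (mem_normalCone_polyhedron_iff.2 ⟨Sum.inr ⁻¹' J, c ∘ Sum.inr, fun i => hslack (.inr i),
      fun i => hc (.inr i), rfl⟩)

end NormalCone

section VariationalInequality

variable {E : Type*} [NormedAddCommGroup E] [InnerProductSpace ℝ E] [FiniteDimensional ℝ E]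

theorem IsPolyhedral.exists_perturbation_bound {C : Set E} (hC : IsPolyhedral C)
    (A : E →ₗ[ℝ] E) (q : E) : ∃ ε > 0, ∃ c : ℝ≥0, ∀ x d, A x + q + d ∈ normalCone C x →
      ‖d‖ ≤ ε → ∃ y, A y + q ∈ normalCone C y ∧ ‖x - y‖ ≤ c * ‖d‖ := by
  have := FiniteDimensional.complete ℝ E
  obtain ⟨k, a, b, rfl⟩ := hC
  let ℓ : Fin k ⊕ Fin k → E × (Fin k → ℝ) →ₗ[ℝ] ℝ := Sum.elim
    (fun i => innerₗ E (a i) ∘ₗ LinearMap.fst ℝ E _)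
    fun i => LinearMap.proj i ∘ₗ LinearMap.snd ℝ E (Fin k → ℝ)
  let T : E × (Fin k → ℝ) →ₗ[ℝ] E :=
    Fintype.linearCombination ℝ a ∘ₗ LinearMap.snd ℝ E _ - A ∘ₗ LinearMap.fst ℝ E _
  have hT (x : E) (u : Fin k → ℝ) : T (x, u) = ∑ i, u i • a i - A x := rfl
  let I (J : Set (Fin k)) : Fin k ⊕ Fin k → Set ℝ :=
    Sum.elim (fun i => (b i - ·) ⁻¹' nonnegOn Jᶜ i) (nonnegOn J)
  obtain ⟨c, hc⟩ := exists_linear_system_error_bound ℓ T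
  have hface (J : Set (Fin k)) := hc (I J)
    (Sum.forall.2 ⟨fun i => (isClosed_nonnegOn Jᶜ i).preimage (by fun_prop),
      isClosed_nonnegOn J⟩)
    (Sum.forall.2 ⟨fun i => (ordConnected_nonnegOn Jᶜ i).preimage_anti fun _ _ h =>
      sub_le_sub_left h _, ordConnected_nonnegOn J⟩) q
  choose ε hε hbound using hface
  obtain ⟨J₀, hJ₀⟩ := Finite.exists_min ε
  refine ⟨ε J₀, hε J₀, c, fun x d hx hd => ?_⟩
  obtain ⟨J, u, hslack, hu, hsum⟩ := mem_normalCone_polyhedron_iff.1 hx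
  have hres : T (x, u) - q = d := by rw [hT, hsum]; abel
  obtain ⟨⟨y, v⟩, hyv, hTyv, hle⟩ := hbound J (x, u) (Sum.forall.2 ⟨hslack, hu⟩)
    (hres ▸ hd.trans (hJ₀ J))
  refine ⟨y, mem_normalCone_polyhedron_iff.2 ⟨J, v, fun i => hyv (.inl i),
    fun i => hyv (.inr i), ?_⟩, ?_⟩
  · rw [← hTyv, hT, add_sub_cancel]
  · exact (norm_fst_le ((x, u) - (y, v))).trans (hres ▸ hle)

theorem IsPolyhedral.exists_residual_bound {C : Set E} (hC : IsPolyhedral C) (hne : C.Nonempty)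
    (A : E →ₗ[ℝ] E) (q : E) : ∃ ε > 0, ∃ τ > 0, ∀ x, ‖x - proj C (x + (A x + q))‖ ≤ ε →
      ∃ y, A y + q ∈ normalCone C y ∧ ‖x - y‖ ≤ τ * ‖x - proj C (x + (A x + q))‖ := by
  have := FiniteDimensional.complete ℝ E
  obtain ⟨ε, hε, c, hbound⟩ := hC.exists_perturbation_bound A q
  set L : ℝ := ‖A.toContinuousLinearMap‖
  refine ⟨ε / (1 + L), by positivity, 1 + c * (1 + L), by positivity, fun x hx => ?_⟩
  set p := proj C (x + (A x + q))
  have hproj : x + (A x + q) - p ∈ normalCone C p :=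
    (isProj_proj hne hC.isClosed.isComplete hC.convex _).sub_mem_normalCone hC.convex
  have hnormal : A p + q + ((x - p) + A (x - p)) ∈ normalCone C p := by
    convert hproj using 1
    rw [map_sub]
    abel
  have hd : ‖(x - p) + A (x - p)‖ ≤ (1 + L) * ‖x - p‖ := by
    rw [one_add_mul]
    exact norm_add_le_of_le le_rfl (A.toContinuousLinearMap.le_opNorm _)
  obtain ⟨y, hy, hle⟩ := hbound p _ hnormal
    (hd.trans ((le_div_iff₀' (by positivity)).1 hx))
  refine ⟨y, hy, ?_⟩
  calc ‖x - y‖ ≤ ‖x - p‖ + ‖p - y‖ := norm_sub_le_norm_sub_add_norm_sub x p y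
    _ ≤ ‖x - p‖ + c * ((1 + L) * ‖x - p‖) := by gcongr; exact hle.trans (by gcongr)
    _ = (1 + c * (1 + L)) * ‖x - p‖ := by ring

end VariationalInequality

section FirstOrderCondition

variable {E : Type*} [NormedAddCommGroup E] [InnerProductSpace ℝ E] [CompleteSpace E]

theorem neg_mem_normalCone_of_isMinOn {C : Set E} (hC : Convex ℝ C) {f : E → ℝ}
    {x g : E} (hx : x ∈ C) (hmin : IsMinOn f C x) (hf : HasGradientAt f g x) :
    -g ∈ normalCone C x := by
  refine ⟨hx, fun y hy => ?_⟩
  have hnonneg := hmin.localize.hasFDerivWithinAt_nonneg hf.hasFDerivAt.hasFDerivWithinAt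
    (sub_mem_posTangentConeAt_of_segment_subset (hC.segment_subset hx hy))
  rw [InnerProductSpace.toDual_apply_apply] at hnonneg
  rw [inner_neg_left]
  linarith

theorem hasGradientAt_inner_apply_self {T : E →L[ℝ] E} (hT : (T : E →ₗ[ℝ] E).IsSymmetric) (x : E) :
    HasGradientAt (fun x => ⟪T x, x⟫) ((2 : ℝ) • T x) x := by
  refine (hT.hasStrictFDerivAt_reApplyInnerSelf x).hasFDerivAt.congr_fderiv ?_
  ext y
  simp

end FirstOrderCondition

section GromovWasserstein

variable {n m : ℕ}

theorem inner_eq_trace (A B : Matrix (Fin n) (Fin m) ℝ) : ⟪A, B⟫ = (Aᵀ * B).trace :=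
  rfl

theorem mem_C₁_iff {μ : Fin n → ℝ} {π : Matrix (Fin n) (Fin m) ℝ} :
    π ∈ C₁ m μ ↔ (∀ i j, 0 ≤ π i j) ∧ ∀ i, ∑ j, π i j = μ i := by
  simp [C₁, funext_iff, Matrix.mulVec, dotProduct]

theorem mem_C₂_iff {ν : Fin m → ℝ} {π : Matrix (Fin n) (Fin m) ℝ} :
    π ∈ C₂ n ν ↔ (∀ i j, 0 ≤ π i j) ∧ ∀ j, ∑ i, π i j = ν j := by
  simp [C₂, funext_iff, Matrix.mulVec, dotProduct]

theorem isPolyhedral_setOf_nonneg_and_eq {κ : Type*} [Finite κ]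
    (f : κ → Matrix (Fin n) (Fin m) ℝ →ₗ[ℝ] ℝ) (r : κ → ℝ) :
    IsPolyhedral {π : Matrix (Fin n) (Fin m) ℝ | (∀ i j, 0 ≤ π i j) ∧ ∀ k, f k π = r k} := by
  have := FiniteDimensional.complete ℝ (Matrix (Fin n) (Fin m) ℝ)
  simp only [ofPred_and, ofPred_forall]
  exact IsPolyhedral.inter
    (.iInter fun i => .iInter fun j =>
      isPolyhedral_setOf_ge (Matrix.entryLinearMap ℝ ℝ i j).toContinuousLinearMap 0)
    (.iInter fun k => isPolyhedral_setOf_eq (f k).toContinuousLinearMap (r k))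

theorem isPolyhedral_C₁ (μ : Fin n → ℝ) : IsPolyhedral (C₁ m μ) := by
  simpa [← mem_C₁_iff] using
    isPolyhedral_setOf_nonneg_and_eq (fun i => ∑ j : Fin m, Matrix.entryLinearMap ℝ ℝ i j) μ

theorem isPolyhedral_C₂ (ν : Fin m → ℝ) : IsPolyhedral (C₂ n ν) := by
  simpa [← mem_C₂_iff] using
    isPolyhedral_setOf_nonneg_and_eq (fun j => ∑ i : Fin n, Matrix.entryLinearMap ℝ ℝ i j) ν

theorem isPolyhedral_couplings (μ : Fin n → ℝ) (ν : Fin m → ℝ) :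
    IsPolyhedral (C₁ m μ ∩ C₂ n ν) :=
  (isPolyhedral_C₁ μ).inter (isPolyhedral_C₂ ν)

theorem couplings_nonempty {μ : Fin n → ℝ} (hμ : μ ∈ stdSimplex ℝ (Fin n)) {ν : Fin m → ℝ}
    (hν : ν ∈ stdSimplex ℝ (Fin m)) : (C₁ m μ ∩ C₂ n ν).Nonempty := by
  have hnonneg (i : Fin n) (j : Fin m) : 0 ≤ Matrix.vecMulVec μ ν i j :=
    mul_nonneg (hμ.1 i) (hν.1 j)
  refine ⟨Matrix.vecMulVec μ ν, mem_C₁_iff.2 ⟨hnonneg, fun i => ?_⟩,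
    mem_C₂_iff.2 ⟨hnonneg, fun j => ?_⟩⟩
  · simp [Matrix.vecMulVec_apply, ← Finset.mul_sum, hν.2]
  · simp [Matrix.vecMulVec_apply, ← Finset.sum_mul, hμ.2]

theorem isCompact_C₁ (μ : Fin n → ℝ) : IsCompact (C₁ m μ) := by
  have hbox : IsCompact {π : Matrix (Fin n) (Fin m) ℝ | ∀ i, π i ∈
      {r : Fin m → ℝ | ∀ j, r j ∈ Icc 0 (μ i)}} :=
    isCompact_pi_infinite fun i => isCompact_pi_infinite fun _ => isCompact_Icc
  refine hbox.of_isClosed_subset (isPolyhedral_C₁ μ).isClosed fun π hπ i j => ?_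
  obtain ⟨hnonneg, hsum⟩ := mem_C₁_iff.1 hπ
  exact ⟨hnonneg i j, hsum i ▸
    Finset.single_le_sum (fun k _ => hnonneg i k) (Finset.mem_univ j)⟩

/-- The linear map `π ↦ D_X π D_Y`, which is `-∇f / 2` for the objective `f` when `D_X` and `D_Y`
are symmetric. -/
def sandwich (DX : Matrix (Fin n) (Fin n) ℝ) (DY : Matrix (Fin m) (Fin m) ℝ) :
    Matrix (Fin n) (Fin m) ℝ →ₗ[ℝ] Matrix (Fin n) (Fin m) ℝ where
  toFun π := DX * π * DY
  map_add' π σ := by rw [Matrix.mul_add, Matrix.add_mul]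
  map_smul' r π := by rw [Matrix.mul_smul, Matrix.smul_mul, RingHom.id_apply]

variable {DX : Matrix (Fin n) (Fin n) ℝ} {DY : Matrix (Fin m) (Fin m) ℝ}

theorem isSymmetric_sandwich (hDX : DX.IsSymm) (hDY : DY.IsSymm) :
    (sandwich DX DY).IsSymmetric := fun π σ => by
  change ⟪DX * π * DY, σ⟫ = ⟪π, DX * σ * DY⟫
  rw [inner_eq_trace, inner_eq_trace, Matrix.transpose_mul, Matrix.transpose_mul, hDX.eq, hDY.eq,
    Matrix.mul_assoc, Matrix.trace_mul_comm]
  simp only [Matrix.mul_assoc]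

theorem objective_eq_neg_inner (π : Matrix (Fin n) (Fin m) ℝ) :
    objective DX DY π = -⟪sandwich DX DY π, π⟫ := by
  rw [real_inner_comm, inner_eq_trace, Matrix.trace_mul_comm]
  rfl

theorem hasGradientAt_objective (hDX : DX.IsSymm) (hDY : DY.IsSymm)
    (π : Matrix (Fin n) (Fin m) ℝ) :
    HasGradientAt (objective DX DY) (-((2 : ℝ) • sandwich DX DY π)) π := by
  have := FiniteDimensional.complete ℝ (Matrix (Fin n) (Fin m) ℝ)
  have hquad := hasGradientAt_inner_apply_self
    (T := (sandwich DX DY).toContinuousLinearMap) (isSymmetric_sandwich hDX hDY) π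
  rw [funext objective_eq_neg_inner, hasGradientAt_iff_hasFDerivAt, map_neg]
  exact hquad.hasFDerivAt.neg

theorem mem_criticalSet_iff (hDX : DX.IsSymm) (hDY : DY.IsSymm) {μ : Fin n → ℝ} {ν : Fin m → ℝ}
    {π : Matrix (Fin n) (Fin m) ℝ} :
    π ∈ criticalSet DX DY μ ν ↔ sandwich DX DY π ∈ normalCone (C₁ m μ ∩ C₂ n ν) π := by
  have := FiniteDimensional.complete ℝ (Matrix (Fin n) (Fin m) ℝ)
  have hzero : 0 ∈ {∇ (objective DX DY) π} + normalCone (C₁ m μ) π + normalCone (C₂ n ν) π ↔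
      sandwich DX DY π ∈ normalCone (C₁ m μ ∩ C₂ n ν) π := by
    rw [(hasGradientAt_objective hDX hDY π).gradient, add_assoc,
      ← (isPolyhedral_C₁ μ).normalCone_inter (isPolyhedral_C₂ ν), singleton_add, mem_image]
    simp [neg_add_eq_zero, smul_mem_normalCone_iff]
  rw [criticalSet, mem_ofPred_eq, hzero]
  exact and_iff_right_of_imp fun h => h.1

theorem criticalSet_nonempty (hDX : DX.IsSymm) (hDY : DY.IsSymm) {μ : Fin n → ℝ} {ν : Fin m → ℝ}
    (hne : (C₁ m μ ∩ C₂ n ν).Nonempty) : (criticalSet DX DY μ ν).Nonempty := by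
  have := FiniteDimensional.complete ℝ (Matrix (Fin n) (Fin m) ℝ)
  obtain ⟨π, hπ, hmin⟩ :=
    ((isCompact_C₁ μ).inter_right (isPolyhedral_C₂ ν).isClosed).exists_isMinOn hne fun π _ =>
      (hasGradientAt_objective hDX hDY π).continuousAt.continuousWithinAt
  have hnormal := neg_mem_normalCone_of_isMinOn (isPolyhedral_couplings μ ν).convex hπ hmin
    (hasGradientAt_objective hDX hDY π)
  rw [neg_neg, smul_mem_normalCone_iff two_pos] at hnormal
  exact ⟨π, (mem_criticalSet_iff hDX hDY).2 hnormal⟩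

end GromovWasserstein

end GW

theorem mainTheorem1_general {n m : ℕ} {DX : Matrix (Fin n) (Fin n) ℝ} (hDX : DX.IsSymm)
    {DY : Matrix (Fin m) (Fin m) ℝ} (hDY : DY.IsSymm) {μ : Fin n → ℝ} {ν : Fin m → ℝ}
    (hne : (GW.C₁ m μ ∩ GW.C₂ n ν).Nonempty) :
    (GW.criticalSet DX DY μ ν).Nonempty ∧
    ∃ ε : ℝ, 0 < ε ∧ ∃ τ : ℝ, 0 < τ ∧
      ∀ π : Matrix (Fin n) (Fin m) ℝ, GW.residual DX DY μ ν π ≤ ε →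
        Metric.infDist π (GW.criticalSet DX DY μ ν) ≤ τ * GW.residual DX DY μ ν π := by
  refine ⟨GW.criticalSet_nonempty hDX hDY hne, ?_⟩
  obtain ⟨ε, hε, τ, hτ, hbound⟩ :=
    (GW.isPolyhedral_couplings μ ν).exists_residual_bound hne (GW.sandwich DX DY) 0
  simp only [add_zero] at hbound
  refine ⟨ε, hε, τ, hτ, fun π hπ => ?_⟩
  obtain ⟨σ, hσ, hle⟩ := hbound π hπ
  calc Metric.infDist π (GW.criticalSet DX DY μ ν) ≤ dist π σ :=
        Metric.infDist_le_dist_of_mem ((GW.mem_criticalSet_iff hDX hDY).2 hσ)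
    _ = ‖π - σ‖ := dist_eq_norm π σ
    _ ≤ τ * GW.residual DX DY μ ν π := hle

theorem mainTheorem1 {n m : ℕ}
    (DX : Matrix (Fin n) (Fin n) ℝ) (hDX : DX.IsSymm)
    (DY : Matrix (Fin m) (Fin m) ℝ) (hDY : DY.IsSymm)
    (μ : Fin n → ℝ) (hμ : μ ∈ stdSimplex ℝ (Fin n))
    (ν : Fin m → ℝ) (hν : ν ∈ stdSimplex ℝ (Fin m)) :
    (GW.criticalSet DX DY μ ν).Nonempty ∧
    ∃ ε : ℝ, 0 < ε ∧ ∃ τ : ℝ, 0 < τ ∧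
      ∀ π : Matrix (Fin n) (Fin m) ℝ, GW.residual DX DY μ ν π ≤ ε →
        Metric.infDist π (GW.criticalSet DX DY μ ν) ≤ τ * GW.residual DX DY μ ν π :=
  mainTheorem1_general hDX hDY (GW.couplings_nonempty hμ hν)
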